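/- Consider preemptive scheduling of $n$ jobs with sizes $x_1,\dots,x_n>0$ on a single machine, where jobs may be run in parallel at rates that sum to at most $1$, and the objective is the sum of the completion times. Let $\mathrm{OPT}(x)$ be the minimum of this objective over all schedules of the instance $x$. For a uniformly random permutation $\sigma$ of $\{1,\dots,n\}$, an algorithm $A$ (deterministic or randomized) knows from the start the exact sizes of the $B$ jobs $\sigma(1),\dots,\sigma(B)$, and learns the size of any other job only when that job completes. Let $\mathbb E[A(x)]$ be its expected objective on $x$, over $\sigma$ and the independent internal randomness of $A$. For $n\ge 2$ and $B\le n$ put $$R_{n,B}(A)=\sup_{x\in(0,\infty)^n}\frac{\mathbb E[A(x)]}{\mathrm{OPT}(x)},$$ and for a sequence $B=(B_n)_n$ of integers with $0\le B_n\le n$ put $\mathrm{CR}_B(A)=\sup_{n\ge2}R_{n,B_n}(A)$. Corollary. Let $w\in[0,1]$. If $B_n=wn+o(n)$ as $n\to\infty$, then every (deterministic or randomized) algorithm $A$ satisfies $$\mathrm{CR}_B(A)\ \ge\ (2-w)-(3-2\sqrt2)\,w(1-w).$$ -/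

import Mathlib

open MeasureTheory Filter Asymptotics
open scoped ENNReal

namespace Scheduling

/-- An instance of `n` jobs: the vector of the (positive) job sizes. -/
abbrev Instance (n : ℕ) : Type := {x : Fin n → ℝ // ∀ i, 0 < x i}

/-- A preemptive schedule of the jobs of `x` on a single machine. `work i t` is the processing time
spent on job `i` until time `t ≥ 0`. Preemption being free, the jobs may be run in parallel at rates
that sum to at most `1`; no time is spent on a job that is completed. Values of `work` at negative
times carry no meaning. -/
structure Schedule {n : ℕ} (x : Instance n) where
  work : Fin n → ℝ → ℝ
  work_zero : ∀ i, work i 0 = 0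
  work_mono : ∀ i s t, 0 ≤ s → s ≤ t → work i s ≤ work i t
  work_rate : ∀ s t, 0 ≤ s → s ≤ t → ∑ i, (work i t - work i s) ≤ t - s
  work_le : ∀ i t, 0 ≤ t → work i t ≤ x.1 i

/-- The completion time `inf {t ≥ 0 | work i t = x i}` of job `i`; it is `∞` if the job is never
completed. -/
noncomputable def Schedule.completionTime {n : ℕ} {x : Instance n} (S : Schedule x) (i : Fin n) :
    ℝ≥0∞ :=
  ⨅ (t : ℝ) (_ : 0 ≤ t ∧ S.work i t = x.1 i), ENNReal.ofReal t

/-- The objective: the sum of the completion times of all the jobs. -/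
noncomputable def Schedule.cost {n : ℕ} {x : Instance n} (S : Schedule x) : ℝ≥0∞ :=
  ∑ i, S.completionTime i

/-- The objective of the optimal offline algorithm: the least sum of completion times among all
schedules of the instance. -/
noncomputable def opt {n : ℕ} (x : Instance n) : ℝ≥0∞ := ⨅ S : Schedule x, S.cost

/-- A deterministic algorithm for `n` jobs that knows the sizes of the `B` jobs `σ k`, `k < B`,
from the start. For each permutation `σ` and each instance `x` it produces a schedule of `x`. The
algorithm learns the size of another job only when that job completes: if `x` and `x'` agree on the
known jobs, and every job whose sizes in `x` and `x'` differ has, in the run on `x`, received until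
time `T` less processing time than either of its two sizes, then `x` and `x'` cannot be told apart
until time `T`, and the two runs coincide on `[0, T]`. -/
structure DeterministicAlgorithm (n B : ℕ) where
  run : Equiv.Perm (Fin n) → (x : Instance n) → Schedule x
  nonanticipating : ∀ (σ : Equiv.Perm (Fin n)) (x x' : Instance n) (T : ℝ), 0 ≤ T →
    (∀ k : Fin n, (k : ℕ) < B → x.1 (σ k) = x'.1 (σ k)) →
    (∀ i, x.1 i ≠ x'.1 i →
      (run σ x).work i T < x.1 i ∧ (run σ x).work i T < x'.1 i) →
    ∀ i t, 0 ≤ t → t ≤ T → (run σ x).work i t = (run σ x').work i t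

/-- A randomized algorithm: a deterministic algorithm drawn at random. The measurability is only in
the random seed `ω`, for a fixed input. Deterministic algorithms are the case of a one-point `Ω`. -/
structure RandomizedAlgorithm (n B : ℕ) where
  Ω : Type*
  measurableSpace : MeasurableSpace Ω
  P : Measure Ω
  isProbabilityMeasure : IsProbabilityMeasure P
  alg : Ω → DeterministicAlgorithm n B
  measurable_work : ∀ (σ : Equiv.Perm (Fin n)) (x : Instance n) (i : Fin n) (t : ℝ), 0 ≤ t →
    Measurable fun ω => ((alg ω).run σ x).work i t

/-- `𝔼[A(x)]`: the expected objective on the instance `x`, over a uniformly random permutation `σ`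
and the independent internal randomness of the algorithm. -/
noncomputable def RandomizedAlgorithm.expectedCost {n B : ℕ} (A : RandomizedAlgorithm n B)
    (x : Instance n) : ℝ≥0∞ :=
  (∑ σ : Equiv.Perm (Fin n),
    @lintegral A.Ω A.measurableSpace A.P fun ω => ((A.alg ω).run σ x).cost) /
      (Fintype.card (Equiv.Perm (Fin n)) : ℝ≥0∞)

/-- The `(n, B)`-competitive ratio: the worst ratio of the expected objective to the optimal offline
objective, over all instances of `n` jobs. -/
noncomputable def RandomizedAlgorithm.ratio {n B : ℕ} (A : RandomizedAlgorithm n B) : ℝ≥0∞ :=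
  ⨆ x : Instance n, A.expectedCost x / opt x

/-- The competitive ratio of `A` when `B n` sizes are known among `n` jobs: the supremum over
`n ≥ 2` of the `(n, B n)`-competitive ratios. -/
noncomputable def competitiveRatio (B : ℕ → ℕ) (A : (n b : ℕ) → RandomizedAlgorithm n b) : ℝ≥0∞ :=
  ⨆ (n : ℕ) (_ : 2 ≤ n), (A n (B n)).ratio

end Scheduling

/-! By averaging, it suffices to bound a deterministic algorithm on random instances. The sizes are
independent and uniform on 1, 1/4, ..., 1/K², a truncated Pareto law with tail t^(-1/2)/K. Every
scale then contributes equally, so expected delays are multiples of H/K², with H the K-th harmonic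
number, and truncation and discretization cost only O(1/K²).

The total completion time is at least half the sum over ordered pairs of the mutual delay
`pairDelay`. For two distinct jobs, K² times the expected delay is bounded below, up to O(1), by -
2H if both are known: the delay is at least the smaller size (`le_sum_min_jobSize`); - 2√2 H if at
least one is unknown: by the time a job of size 1/l² completes, the unknown one has received some
amount S, and even the best S, about 1/(2l²), costs 2√2/l (`le_sum_min_add_ite`); - 4H if both are
unknown: when the pair has received 2/m² in total, at least m² - 2m of the K² size pairs are still
undetected, however the work was split (`le_sizeCount_mul_sizeCount`), and a layer-cake sum gives 4H
(`le_sum_of_tail_bound`).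

For unknown jobs, non-anticipation reduces all sizes to one reference run in which those jobs have
the maximal size 1 (`work_add_work_le_pairDelay_run`). The expected optimum is at most (n²H +
K²n)/K². With a fraction w of known jobs, letting first n and then K tend to infinity leaves the
ratio w² + 2√2 w(1-w) + 2(1-w)², which is the claim. -/

namespace Scheduling

/-! ### Schedules, completion times and mutual delays of pairs. -/

namespace Schedule

variable {n : ℕ} {x : Instance n}

lemma work_sub_le (S : Schedule x) (i : Fin n) {s t : ℝ} (hs : 0 ≤ s) (hst : s ≤ t) :
    S.work i t - S.work i s ≤ t - s :=
  (Finset.single_le_sum (f := fun i => S.work i t - S.work i s)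
    (fun j _ => sub_nonneg.2 (S.work_mono j s t hs hst)) (Finset.mem_univ i)).trans
      (S.work_rate s t hs hst)

lemma continuousOn_work (S : Schedule x) (i : Fin n) :
    ContinuousOn (S.work i) (Set.Ici 0) := by
  refine (LipschitzOnWith.of_le_add_mul 1 fun s hs t ht => ?_).continuousOn
  rw [Real.dist_eq, NNReal.coe_one, one_mul]
  rcases le_total s t with h | h
  · linarith [S.work_mono i s t hs h, abs_nonneg (s - t)]
  · linarith [S.work_sub_le i ht h, le_abs_self (s - t)]

lemma work_nonneg (S : Schedule x) (i : Fin n) {t : ℝ} (ht : 0 ≤ t) : 0 ≤ S.work i t := by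
  simpa [S.work_zero i] using S.work_mono i 0 t le_rfl ht

/-- The completion time of a job as a real number. -/
noncomputable def finish (S : Schedule x) (i : Fin n) : ℝ := (S.completionTime i).toReal

lemma finish_nonneg (S : Schedule x) (i : Fin n) : 0 ≤ S.finish i := ENNReal.toReal_nonneg

/-- The infimum defining the completion time is attained, because `work` is continuous and the set
of admissible times is closed. -/
lemma work_finish (S : Schedule x) {i : Fin n} (h : S.completionTime i ≠ ⊤) :
    S.work i (S.finish i) = x.1 i := by
  set s : Set ℝ := {t | 0 ≤ t ∧ S.work i t = x.1 i} with hs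
  have hne : s.Nonempty := by
    by_contra hemp
    refine h (iInf₂_eq_top.2 fun t ht => ?_)
    exact absurd ⟨t, ht⟩ hemp
  have hcl : IsClosed s := by
    have := (S.continuousOn_work i).preimage_isClosed_of_isClosed isClosed_Ici
      (isClosed_singleton (x := x.1 i))
    exact this
  have hbdd : BddBelow s := ⟨0, fun t ht => ht.1⟩
  have hmem : sInf s ∈ s := hcl.csInf_mem hne hbdd
  have heq : S.completionTime i = ENNReal.ofReal (sInf s) :=
    le_antisymm (iInf₂_le (sInf s) hmem)
      (le_iInf₂ fun t ht => ENNReal.ofReal_le_ofReal (csInf_le hbdd ht))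
  rw [finish, heq, ENNReal.toReal_ofReal hmem.1]
  exact hmem.2

lemma le_finish_of_work_lt (S : Schedule x) {i : Fin n} (h : S.completionTime i ≠ ⊤) {t : ℝ}
    (hw : S.work i t < x.1 i) : t ≤ S.finish i := by
  by_contra! hlt
  have := S.work_mono i _ t (S.finish_nonneg i) hlt.le
  rw [S.work_finish h] at this
  linarith

/-- Finiteness is not needed: for a job that never completes, `finish` is 0 and no `t` qualifies. -/
lemma work_lt_of_lt_finish (S : Schedule x) {i : Fin n} {t : ℝ}
    (h0 : 0 ≤ t) (ht : t < S.finish i) : S.work i t < x.1 i := by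
  refine lt_of_le_of_ne (S.work_le i t h0) fun he => ?_
  have h1 : S.completionTime i ≤ ENNReal.ofReal t := iInf₂_le t ⟨h0, he⟩
  have h2 := ENNReal.toReal_mono ENNReal.ofReal_ne_top h1
  rw [ENNReal.toReal_ofReal h0] at h2
  exact absurd ht (not_lt.2 h2)

/-- The total time by which two jobs delay each other. -/
noncomputable def pairDelay (S : Schedule x) (i j : Fin n) : ℝ :=
  S.work i (S.finish j) + S.work j (S.finish i)

lemma pairDelay_nonneg (S : Schedule x) (i j : Fin n) : 0 ≤ S.pairDelay i j :=
  add_nonneg (S.work_nonneg i (S.finish_nonneg j)) (S.work_nonneg j (S.finish_nonneg i))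

lemma pairDelay_comm (S : Schedule x) (i j : Fin n) : S.pairDelay i j = S.pairDelay j i :=
  add_comm _ _

lemma work_add_work_le_pairDelay (S : Schedule x) {i j : Fin n}
    (hi : S.completionTime i ≠ ⊤) (hj : S.completionTime j ≠ ⊤) {t : ℝ} (h0 : 0 ≤ t)
    (hti : S.work i t < x.1 i) (htj : S.work j t < x.1 j) :
    S.work i t + S.work j t ≤ S.pairDelay i j :=
  add_le_add (S.work_mono i _ _ h0 (S.le_finish_of_work_lt hj htj))
    (S.work_mono j _ _ h0 (S.le_finish_of_work_lt hi hti))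

lemma min_le_pairDelay (S : Schedule x) {i j : Fin n}
    (hi : S.completionTime i ≠ ⊤) (hj : S.completionTime j ≠ ⊤) :
    min (x.1 i) (x.1 j) ≤ S.pairDelay i j := by
  have h1 := S.work_finish hi
  have h2 := S.work_finish hj
  have h3 := S.work_nonneg i (S.finish_nonneg j)
  have h4 := S.work_nonneg j (S.finish_nonneg i)
  unfold pairDelay
  rcases le_total (S.finish i) (S.finish j) with h | h
  · have := S.work_mono i _ _ (S.finish_nonneg i) h
    linarith [min_le_left (x.1 i) (x.1 j)]
  · have := S.work_mono j _ _ (S.finish_nonneg j) h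
    linarith [min_le_right (x.1 i) (x.1 j)]

/-- The machine has unit speed, so a completion time is at least the work done on all jobs until
then. The factor 1/2 is there because each pair is counted in both orders. -/
lemma sum_pairDelay_le (S : Schedule x) :
    1 / 2 * ∑ i, ∑ j, S.pairDelay i j ≤ ∑ i, S.finish i := by
  have h1 : ∑ i, ∑ j, S.pairDelay i j = 2 * ∑ i, ∑ j, S.work j (S.finish i) := by
    simp only [pairDelay, Finset.sum_add_distrib]
    rw [Finset.sum_comm]
    ring
  have h2 : ∑ i, ∑ j, S.work j (S.finish i) ≤ ∑ i, S.finish i := by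
    refine Finset.sum_le_sum fun i _ => ?_
    simpa [S.work_zero] using S.work_rate 0 (S.finish i) le_rfl (S.finish_nonneg i)
  linarith

lemma cost_eq_ofReal (S : Schedule x) (h : ∀ i, S.completionTime i ≠ ⊤) :
    S.cost = ENNReal.ofReal (∑ i, S.finish i) := by
  rw [ENNReal.ofReal_sum_of_nonneg fun i _ => S.finish_nonneg i]
  exact Finset.sum_congr rfl fun i _ => (ENNReal.ofReal_toReal (h i)).symm

/-- A completed job stays completed, so rational times suffice. The countable infimum is what makes
the cost measurable in the seed. -/
lemma completionTime_eq_iInf_rat (S : Schedule x) (i : Fin n) :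
    S.completionTime i =
      ⨅ q : {q : ℚ // 0 ≤ q}, if S.work i (q.1 : ℝ) = x.1 i then ENNReal.ofReal (q.1 : ℝ)
        else ⊤ := by
  refine le_antisymm (le_iInf fun q => ?_) (le_iInf₂ fun t ht => ?_)
  · split_ifs with h
    · exact iInf₂_le (q.1 : ℝ) ⟨by exact_mod_cast q.2, h⟩
    · exact le_top
  · refine ENNReal.le_of_forall_pos_le_add fun ε hε _ => ?_
    obtain ⟨q, hq1, hq2⟩ := exists_rat_btwn (show t < t + ε by simpa using hε)
    have hq0 : 0 ≤ q := by exact_mod_cast ht.1.trans hq1.le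
    refine (iInf_le _ ⟨q, hq0⟩).trans ?_
    have hw : S.work i (q : ℝ) = x.1 i := by
      refine le_antisymm (S.work_le i _ (ht.1.trans hq1.le)) ?_
      rw [← ht.2]
      exact S.work_mono i _ _ ht.1 hq1.le
    simp only [hw, if_true]
    refine (ENNReal.ofReal_le_ofReal hq2.le).trans ?_
    rw [ENNReal.ofReal_add ht.1 ε.coe_nonneg, ENNReal.ofReal_coe_nnreal]

end Schedule

lemma RandomizedAlgorithm.measurable_cost {n B : ℕ} (A : RandomizedAlgorithm n B)
    (σ : Equiv.Perm (Fin n)) (x : Instance n) :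
    @Measurable _ _ A.measurableSpace _ fun ω => ((A.alg ω).run σ x).cost := by
  let := A.measurableSpace
  unfold Schedule.cost
  refine Finset.measurable_sum _ fun i _ => ?_
  simp_rw [Schedule.completionTime_eq_iInf_rat]
  refine Measurable.iInf fun q => ?_
  refine Measurable.ite ?_ measurable_const measurable_const
  exact (A.measurable_work σ x i q.1 (by exact_mod_cast q.2)) (measurableSet_singleton (x.1 i))

/-! ### Upper bound on the optimum. -/

/-- The schedule that runs the jobs one after the other in the order `σ 0, σ 1, …`, where the
first `r` jobs take time `p r`. -/
noncomputable def sequentialSchedule {n : ℕ} (x : Instance n) (σ : Equiv.Perm (Fin n))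
    (p : ℕ → ℝ) (p_zero : p 0 = 0) (p_succ : ∀ r : Fin n, p (r + 1) = p r + x.1 (σ r))
    (p_nonneg : ∀ r, 0 ≤ p r) : Schedule x where
  work i t := min t (p ((σ.symm i : ℕ) + 1)) - min t (p (σ.symm i : ℕ))
  work_zero i := by simp [p_nonneg]
  work_mono i s t _ hst := by
    have h := p_succ (σ.symm i)
    have hx := x.2 (σ (σ.symm i))
    simp only [min_def]
    split_ifs <;> linarith
  work_rate s t hs hst := by
    have key : ∀ t, 0 ≤ t →
        ∑ i, (min t (p ((σ.symm i : ℕ) + 1)) - min t (p (σ.symm i : ℕ))) = min t (p n) := by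
      intro t ht
      rw [← Equiv.sum_comp σ]
      simp only [Equiv.symm_apply_apply]
      rw [Fin.sum_univ_eq_sum_range (fun r => min t (p (r + 1)) - min t (p r)) n,
        Finset.sum_range_sub (fun r => min t (p r)), p_zero, min_eq_right ht, sub_zero]
    rw [Finset.sum_sub_distrib, key t (hs.trans hst), key s hs]
    simp only [min_def]
    split_ifs <;> linarith
  work_le i t _ := by
    have h := p_succ (σ.symm i)
    have hx := x.2 (σ (σ.symm i))
    rw [σ.apply_symm_apply] at h hx
    simp only [min_def]
    split_ifs <;> linarith

lemma sum_range_sum_range_eq_of_monotone (y : ℕ → ℝ) (n : ℕ)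
    (hy : ∀ j k, j ≤ k → k < n → y j ≤ y k) :
    ∑ r ∈ Finset.range n, ∑ j ∈ Finset.range (r + 1), y j =
      1 / 2 * ∑ r ∈ Finset.range n, ∑ j ∈ Finset.range n, min (y r) (y j) +
        1 / 2 * ∑ r ∈ Finset.range n, y r := by
  induction n with
  | zero => simp
  | succ n ih =>
    have h1 : ∀ r ∈ Finset.range n, min (y r) (y n) = y r := fun r hr =>
      min_eq_left (hy r n (Finset.mem_range.1 hr).le n.lt_succ_self)
    have h2 : ∀ r ∈ Finset.range n, min (y n) (y r) = y r := fun r hr =>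
      min_eq_right (hy r n (Finset.mem_range.1 hr).le n.lt_succ_self)
    rw [Finset.sum_range_succ, ih fun j k hjk hk => hy j k hjk (hk.trans n.lt_succ_self)]
    simp only [Finset.sum_range_succ, Finset.sum_add_distrib]
    rw [Finset.sum_congr rfl h1, Finset.sum_congr rfl h2, min_self]
    ring

/-- Running the jobs by increasing size delays each pair by the smaller of its two sizes. -/
lemma opt_le {n : ℕ} (x : Instance n) :
    opt x ≤ ENNReal.ofReal
      (1 / 2 * ∑ i, ∑ j, min (x.1 i) (x.1 j) + 1 / 2 * ∑ i, x.1 i) := by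
  set σ := Tuple.sort x.1 with hσ
  have hmono : Monotone (x.1 ∘ σ) := Tuple.monotone_sort x.1
  set y : ℕ → ℝ := fun j => if h : j < n then x.1 (σ ⟨j, h⟩) else 0 with hy
  have hyv : ∀ r : Fin n, y r = x.1 (σ r) := fun r => by simp [hy]
  have hy0 : ∀ j, 0 ≤ y j := fun j => by
    simp only [hy]
    split_ifs
    · exact (x.2 _).le
    · exact le_rfl
  set p : ℕ → ℝ := fun r => ∑ j ∈ Finset.range r, y j with hp
  have hps : ∀ r : Fin n, p (r + 1) = p r + x.1 (σ r) := fun r => by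
    simp only [hp, Finset.sum_range_succ, hyv]
  have hp0 : ∀ r, 0 ≤ p r := fun r => Finset.sum_nonneg fun j _ => hy0 j
  set S := sequentialSchedule x σ p (by simp [hp]) hps hp0
  have hS : ∀ i, S.completionTime i ≤ ENNReal.ofReal (p ((σ.symm i : ℕ) + 1)) := fun i => by
    refine iInf₂_le _ ⟨hp0 _, ?_⟩
    change min (p ((σ.symm i : ℕ) + 1)) (p ((σ.symm i : ℕ) + 1)) -
      min (p ((σ.symm i : ℕ) + 1)) (p (σ.symm i : ℕ)) = x.1 i
    have h := hps (σ.symm i)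
    have hx := x.2 i
    rw [σ.apply_symm_apply] at h
    rw [min_self, min_eq_right (by linarith), h]
    ring
  refine (iInf_le _ S).trans ((Finset.sum_le_sum fun i _ => hS i).trans (le_of_eq ?_))
  rw [← ENNReal.ofReal_sum_of_nonneg fun i _ => hp0 _]
  congr 1
  rw [← Equiv.sum_comp σ, ← Equiv.sum_comp σ x.1,
    ← Equiv.sum_comp σ (fun i => ∑ j, min (x.1 i) (x.1 j))]
  simp only [Equiv.symm_apply_apply]
  have h3 : ∀ i, ∑ j, min (x.1 (σ i)) (x.1 j) = ∑ j : Fin n, min (y i) (y j) := fun i => by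
    rw [← Equiv.sum_comp σ]
    simp only [hyv]
  simp only [h3]
  simp only [← hyv]
  rw [Fin.sum_univ_eq_sum_range (fun r => p (r + 1)) n, Fin.sum_univ_eq_sum_range y n,
    Fin.sum_univ_eq_sum_range (fun r => ∑ j : Fin n, min (y r) (y j)) n]
  have h4 : ∀ r, ∑ j : Fin n, min (y r) (y j) = ∑ j ∈ Finset.range n, min (y r) (y j) :=
    fun r => Fin.sum_univ_eq_sum_range (fun j => min (y r) (y j)) n
  simp only [h4]
  refine sum_range_sum_range_eq_of_monotone y n fun j k hjk hk => ?_
  have := hmono (show (⟨j, hjk.trans_lt hk⟩ : Fin n) ≤ ⟨k, hk⟩ from hjk)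
  simpa [hy, hk, hjk.trans_lt hk] using this

/-! ### The size distribution and its extremal estimates. -/

/-- The sizes `1, 1/4, 1/9, …` of the jobs of the hard instances. -/
noncomputable def jobSize (k : ℕ) : ℝ := 1 / ((k : ℝ) + 1) ^ 2

/-- The `K`-th harmonic number. -/
noncomputable def harmonicSum (K : ℕ) : ℝ := ∑ k ∈ Finset.range K, 1 / ((k : ℝ) + 1)

/-- The number of the first `K` sizes that exceed `t`. -/
noncomputable def sizeCount (K : ℕ) (t : ℝ) : ℕ :=
  (Finset.univ.filter fun k : Fin K => t < jobSize k).card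

lemma jobSize_pos (k : ℕ) : 0 < jobSize k := by unfold jobSize; positivity

lemma jobSize_antitone : Antitone jobSize := fun k l h => by
  unfold jobSize
  gcongr

lemma jobSize_zero : jobSize 0 = 1 := by simp [jobSize]

lemma jobSize_le_one (k : ℕ) : jobSize k ≤ 1 := jobSize_zero ▸ jobSize_antitone k.zero_le

lemma harmonicSum_nonneg (K : ℕ) : 0 ≤ harmonicSum K :=
  Finset.sum_nonneg fun _ _ => by positivity

/-- The sizes decrease, so those exceeding `t` form an initial segment; unless it is everything, the
next size is at most `t`. -/
lemma sizeCount_eq_or (K : ℕ) (t : ℝ) :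
    sizeCount K t = K ∨ sizeCount K t < K ∧ 1 / ((sizeCount K t : ℝ) + 1) ^ 2 ≤ t := by
  have hle : sizeCount K t ≤ K := by
    simpa [sizeCount] using
      Finset.card_filter_le (Finset.univ : Finset (Fin K)) fun k => t < jobSize k
  rcases hle.eq_or_lt with h | h
  · exact Or.inl h
  refine Or.inr ⟨h, ?_⟩
  by_contra! hlt
  have hsub : Finset.Iic (⟨sizeCount K t, h⟩ : Fin K) ⊆
      Finset.univ.filter fun k : Fin K => t < jobSize k := fun k hk => by
    rw [Finset.mem_filter]
    refine ⟨Finset.mem_univ _, hlt.trans_le (jobSize_antitone ?_)⟩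
    exact Fin.le_def.1 (Finset.mem_Iic.1 hk)
  have := Finset.card_le_card hsub
  rw [Fin.card_Iic] at this
  change sizeCount K t + 1 ≤ sizeCount K t at this
  omega

lemma sum_range_jobSize_le (K : ℕ) :
    ∑ k ∈ Finset.range K, jobSize k ≤ 2 - 2 / ((K : ℝ) + 1) := by
  induction K with
  | zero => simp
  | succ K ih =>
    rw [Finset.sum_range_succ]
    have : jobSize K ≤ 2 / ((K : ℝ) + 1) - 2 / ((K + 1 : ℕ) + 1 : ℝ) := by
      unfold jobSize
      push_cast
      have hK : (0 : ℝ) ≤ K := K.cast_nonneg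
      rw [div_sub_div _ _ (by positivity) (by positivity), div_le_div_iff₀ (by positivity) (by positivity)]
      nlinarith [mul_nonneg hK hK, mul_nonneg hK (mul_nonneg hK hK)]
    linarith

/-- The minimum is the size at the larger index, and 2k + 1 pairs have larger index k; their
contribution is 2/(k+1) - 1/(k+1)². -/
lemma sum_range_min_jobSize (K : ℕ) :
    ∑ k ∈ Finset.range K, ∑ l ∈ Finset.range K, min (jobSize k) (jobSize l) =
      2 * harmonicSum K - ∑ k ∈ Finset.range K, jobSize k := by
  induction K with
  | zero => simp [harmonicSum]
  | succ K ih =>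
    have h1 : ∀ k ∈ Finset.range K, min (jobSize k) (jobSize K) = jobSize K := fun k hk =>
      min_eq_right (jobSize_antitone (Finset.mem_range.1 hk).le)
    have h2 : ∀ k ∈ Finset.range K, min (jobSize K) (jobSize k) = jobSize K := fun k hk =>
      min_eq_left (jobSize_antitone (Finset.mem_range.1 hk).le)
    unfold harmonicSum at ih ⊢
    simp only [Finset.sum_range_succ, Finset.sum_add_distrib]
    rw [Finset.sum_congr rfl h1, Finset.sum_congr rfl h2, min_self, ih]
    simp only [Finset.sum_const, Finset.card_range, nsmul_eq_mul, jobSize]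
    field_simp
    ring

lemma sum_min_jobSize (K : ℕ) :
    ∑ k : Fin K, ∑ l : Fin K, min (jobSize k) (jobSize l) =
      2 * harmonicSum K - ∑ k ∈ Finset.range K, jobSize k := by
  rw [← sum_range_min_jobSize, ← Fin.sum_univ_eq_sum_range]
  simp only [← Fin.sum_univ_eq_sum_range (fun l => min (jobSize _) (jobSize l)) K]

lemma sum_min_jobSize_le (K : ℕ) :
    ∑ k : Fin K, ∑ l : Fin K, min (jobSize k) (jobSize l) ≤ 2 * harmonicSum K := by
  rw [sum_min_jobSize]
  linarith [Finset.sum_nonneg fun k (_ : k ∈ Finset.range K) => (jobSize_pos k).le]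

lemma le_sum_min_jobSize (K : ℕ) :
    2 * harmonicSum K - 2 ≤ ∑ k : Fin K, ∑ l : Fin K, min (jobSize k) (jobSize l) := by
  rw [sum_min_jobSize]
  have : (0 : ℝ) ≤ 2 / ((K : ℝ) + 1) := by positivity
  linarith [sum_range_jobSize_le K]

/-- The first `M` terms are capped and add up to 1/M; the others are compared with a telescoping
sum. -/
lemma le_sum_range_min_jobSize {M K : ℕ} (hM : 1 ≤ M) (hMK : M ≤ K) :
    1 / (M : ℝ) + 1 / ((M : ℝ) + 1) - 1 / ((K : ℝ) + 1) ≤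
      ∑ k ∈ Finset.range K, min (jobSize k) (1 / (M : ℝ) ^ 2) := by
  have hM0 : (0 : ℝ) < M := by exact_mod_cast hM
  induction K, hMK using Nat.le_induction with
  | base =>
    have h1 : ∀ k ∈ Finset.range M, min (jobSize k) (1 / (M : ℝ) ^ 2) = 1 / (M : ℝ) ^ 2 := by
      intro k hk
      refine min_eq_right ?_
      unfold jobSize
      have : (k : ℝ) + 1 ≤ M := by exact_mod_cast Finset.mem_range.1 hk
      gcongr
    rw [Finset.sum_congr rfl h1, Finset.sum_const, Finset.card_range, nsmul_eq_mul]
    refine le_of_eq ?_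
    field_simp
    ring
  | succ K hK ih =>
    rw [Finset.sum_range_succ]
    have h1 : min (jobSize K) (1 / (M : ℝ) ^ 2) = jobSize K := by
      refine min_eq_left ?_
      unfold jobSize
      have : (M : ℝ) ≤ K := by exact_mod_cast hK
      gcongr
      linarith
    have h2 : 1 / ((K : ℝ) + 1) - 1 / ((K + 1 : ℕ) + 1 : ℝ) ≤ jobSize K := by
      unfold jobSize
      push_cast
      rw [div_sub_div _ _ (by positivity) (by positivity),
        div_le_div_iff₀ (by positivity) (by positivity)]
      nlinarith [(Nat.cast_nonneg K : (0 : ℝ) ≤ K)]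
    rw [h1]
    linarith

/-- The optimal threshold at which an unknown job should be interrupted in favour of a known job
of size `1 / l ^ 2`. -/
lemma le_sum_min_add_ite {K : ℕ} {l : ℝ} (hl : 1 ≤ l) (hlK : l ≤ K) {S : ℝ} (hS : 0 ≤ S) :
    2 * √2 / l - 9 / l ^ 2 - 9 / K ≤
      ∑ k : Fin K, (min (jobSize k) S + if S < jobSize k then 1 / l ^ 2 else 0) := by
  have hl0 : 0 < l := by linarith
  have hK0 : (0 : ℝ) < K := by linarith
  have hr0 : 0 ≤ √2 := Real.sqrt_nonneg 2
  have hr : √2 ^ 2 = 2 := Real.sq_sqrt (by norm_num)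
  have hr1 : √2 ≤ 3 / 2 := by nlinarith
  have hcount : ∑ k : Fin K, (if S < jobSize k then 1 / l ^ 2 else 0) =
      sizeCount K S * (1 / l ^ 2) := by
    rw [← Finset.sum_filter, Finset.sum_const, nsmul_eq_mul, sizeCount]
  rw [Finset.sum_add_distrib, hcount]
  rcases sizeCount_eq_or K S with h | ⟨hlt, hle⟩
  · rw [h]
    have h0 : 0 ≤ ∑ k : Fin K, min (jobSize k) S :=
      Finset.sum_nonneg fun k _ => le_min (jobSize_pos k).le hS
    have h9 : 0 ≤ 9 / l ^ 2 := by positivity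
    have h9K : 0 ≤ 9 / (K : ℝ) := by positivity
    -- Here `S` is below every size, and interruption alone costs K/l². This suffices if K ≥ 3l;
    -- otherwise the error term 9/K covers the claim.
    rcases le_total (3 * l) K with h3 | h3
    · have : 2 * √2 / l ≤ K * (1 / l ^ 2) := by
        rw [mul_one_div, div_le_div_iff₀ hl0 (by positivity)]
        nlinarith [mul_nonneg hl0.le hl0.le]
      linarith
    · have : 2 * √2 / l ≤ 9 / K := by
        rw [div_le_div_iff₀ hl0 hK0]
        nlinarith
      have : (0 : ℝ) ≤ K * (1 / l ^ 2) := by positivity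
      linarith
  · set N := sizeCount K S with hN
    have h1 := le_sum_range_min_jobSize (M := N + 1) (K := K) (by omega) hlt
    rw [← Fin.sum_univ_eq_sum_range (fun k => min (jobSize k) (1 / ((N + 1 : ℕ) : ℝ) ^ 2))] at h1
    push_cast at h1
    have h2 : ∑ k : Fin K, min (jobSize k) (1 / ((N : ℝ) + 1) ^ 2) ≤
        ∑ k : Fin K, min (jobSize k) S :=
      Finset.sum_le_sum fun k _ => min_le_min le_rfl hle
    set M : ℝ := (N : ℝ) + 1 with hM
    have hM1 : 1 ≤ M := by simp [hM]
    have hM0 : 0 < M := by linarith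
    have hNM : (N : ℝ) * (1 / l ^ 2) = M / l ^ 2 - 1 / l ^ 2 := by rw [hM]; ring
    rw [hNM]
    have h3 : 1 / M - 1 / M ^ 2 ≤ 1 / (M + 1) := by
      rw [div_sub_div _ _ hM0.ne' (by positivity), div_le_div_iff₀ (by positivity) (by positivity)]
      nlinarith [mul_pos hM0 hM0]
    have h4 : 1 / ((K : ℝ) + 1) ≤ 9 / K := by
      rw [div_le_div_iff₀ (by positivity) hK0]
      linarith
    have e1 : 9 / l ^ 2 = 8 / l ^ 2 + 1 / l ^ 2 := by ring
    suffices h5 : 2 * √2 / l - 8 / l ^ 2 ≤ 2 * (1 / M) - 1 / M ^ 2 + M / l ^ 2 by linarith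
    -- If `M` is not small compared with `l`, the term 1/M² is absorbed by 8/l² and completing the
    -- square applies, with equality at M = √2 l. Otherwise 1/M alone is large enough.
    rcases le_total (l ^ 2) (8 * M ^ 2) with h | h
    · have h6 : 1 / M ^ 2 ≤ 8 / l ^ 2 := by
        rw [div_le_div_iff₀ (by positivity) (by positivity)]
        linarith
      have h7 : 2 * √2 / l ≤ 2 * (1 / M) + M / l ^ 2 := by
        have : 2 * (1 / M) + M / l ^ 2 - 2 * √2 / l = (√2 * l - M) ^ 2 / (M * l ^ 2) := by
          field_simp
          nlinarith
        have h8 : 0 ≤ (√2 * l - M) ^ 2 / (M * l ^ 2) := by positivity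
        linarith
      linarith
    · have h6 : 1 / M ^ 2 ≤ 1 / M := by
        rw [div_le_div_iff₀ (by positivity) (by positivity)]
        nlinarith
      have h7 : 2 * √2 / l ≤ 1 / M := by
        rw [div_le_div_iff₀ hl0 hM0]
        have : (2 * √2 * M) ^ 2 ≤ l ^ 2 := by
          rw [mul_pow, mul_pow, hr]
          linarith
        have := (abs_le_of_sq_le_sq' this hl0.le).2
        linarith
      have : 0 ≤ 8 / l ^ 2 := by positivity
      have : 0 ≤ M / l ^ 2 := by positivity
      linarith

lemma sum_threshold_bound (K : ℕ) :
    2 * √2 * harmonicSum K - 27 ≤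
      ∑ l : Fin K, (2 * √2 / ((l : ℝ) + 1) - 9 / ((l : ℝ) + 1) ^ 2 - 9 / K) := by
  rw [Fin.sum_univ_eq_sum_range
    (fun l : ℕ => 2 * √2 / ((l : ℝ) + 1) - 9 / ((l : ℝ) + 1) ^ 2 - 9 / K) K,
    Finset.sum_sub_distrib, Finset.sum_sub_distrib]
  have h1 : ∑ l ∈ Finset.range K, 2 * √2 / ((l : ℝ) + 1) = 2 * √2 * harmonicSum K := by
    rw [harmonicSum, Finset.mul_sum]
    exact Finset.sum_congr rfl fun l _ => by ring
  have h2 : ∑ l ∈ Finset.range K, 9 / ((l : ℝ) + 1) ^ 2 =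
      9 * ∑ l ∈ Finset.range K, jobSize l := by
    rw [Finset.mul_sum]
    exact Finset.sum_congr rfl fun l _ => by rw [jobSize]; ring
  have h3 : ∑ l ∈ Finset.range K, 9 / (K : ℝ) ≤ 9 := by
    rw [Finset.sum_const, Finset.card_range, nsmul_eq_mul]
    rcases Nat.eq_zero_or_pos K with h | h
    · simp [h]
    · have : (0 : ℝ) < K := by exact_mod_cast h
      rw [mul_div_cancel₀ _ this.ne']
  have h4 := sum_range_jobSize_le K
  have h5 : (0 : ℝ) ≤ 2 / ((K : ℝ) + 1) := by positivity
  linarith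

/-- Log-convexity of the tail of the size distribution, up to discretization errors. -/
lemma le_sizeCount_mul_sizeCount {K m : ℕ} (hm : 2 ≤ m) (hmK : 2 * m ≤ K) {p r : ℝ}
    (hp : 0 ≤ p) (hr : 0 ≤ r) (hpr : p + r = 2 / (m : ℝ) ^ 2) :
    (m : ℝ) ^ 2 - 2 * m ≤ sizeCount K p * sizeCount K r := by
  have hm2 : (2 : ℝ) ≤ m := by exact_mod_cast hm
  have hm0 : (0 : ℝ) < m := by linarith
  have hK2 : 2 * (m : ℝ) ≤ K := by exact_mod_cast hmK
  -- The case where the other count is saturated at `K`: then K ≥ 2m, and a count of at least m/2 -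
  -- 1 is enough.
  have aux : ∀ r : ℝ, r ≤ 2 / (m : ℝ) ^ 2 → (m : ℝ) ^ 2 - 2 * m ≤ K * sizeCount K r := by
    intro r hr2
    rcases sizeCount_eq_or K r with h | ⟨-, hle⟩
    · rw [h]
      nlinarith
    · set R : ℝ := (sizeCount K r : ℝ) + 1 with hR
      have hR1 : 1 ≤ R := by simp [hR]
      have h1 : 1 / R ^ 2 ≤ 2 / (m : ℝ) ^ 2 := hle.trans hr2
      rw [div_le_div_iff₀ (by positivity) (by positivity)] at h1
      have h2 : (m : ℝ) ≤ 2 * R := by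
        refine abs_le_of_sq_le_sq' (by nlinarith) (by linarith) |>.2
      have h3 : (sizeCount K r : ℝ) = R - 1 := by rw [hR]; ring
      rw [h3]
      nlinarith
  have hm22 : (m : ℝ) ^ 2 * (2 / (m : ℝ) ^ 2) = 2 := by field_simp
  rcases sizeCount_eq_or K p with h | ⟨-, hlep⟩
  · rw [h]
    exact aux r (by linarith)
  rcases sizeCount_eq_or K r with h | ⟨-, hler⟩
  · rw [h, mul_comm (sizeCount K p : ℝ)]
    exact aux p (by linarith)
  have h3 : (sizeCount K p : ℝ) = ((sizeCount K p : ℝ) + 1) - 1 := by ring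
  have h4 : (sizeCount K r : ℝ) = ((sizeCount K r : ℝ) + 1) - 1 := by ring
  rw [h3, h4]
  set P : ℝ := (sizeCount K p : ℝ) + 1
  set R : ℝ := (sizeCount K r : ℝ) + 1
  have hP : 0 < P := by positivity
  have hR : 0 < R := by positivity
  set a := 1 / P with ha
  set b := 1 / R with hb
  have hab : a ^ 2 + b ^ 2 ≤ 2 / (m : ℝ) ^ 2 := by
    rw [← hpr, ha, hb, one_div_pow, one_div_pow]
    exact add_le_add hlep hler
  have ha0 : 0 < a := by positivity
  have hb0 : 0 < b := by positivity
  -- With a² + b² ≤ 2/m², both a + b and ab are largest at a = b = 1/m: an even split of the work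
  -- leaves the fewest undetected pairs.
  have hsum : a + b ≤ 2 / m := by
    refine (abs_le_of_sq_le_sq' ?_ (by positivity)).2
    rw [div_pow]
    have : (2 : ℝ) ^ 2 / (m : ℝ) ^ 2 = 2 * (2 / (m : ℝ) ^ 2) := by ring
    nlinarith [sq_nonneg (a - b)]
  have hprod : (m : ℝ) ^ 2 ≤ P * R := by
    have h1 : a * b * (P * R) = 1 := by rw [ha, hb]; field_simp
    have h2 : 2 * (a * b) ≤ 2 / (m : ℝ) ^ 2 := by nlinarith [sq_nonneg (a - b)]
    have h3 : (m : ℝ) ^ 2 * (a * b) ≤ 1 := by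
      have := mul_le_mul_of_nonneg_left h2 (sq_nonneg (m : ℝ))
      linarith
    have h5 : (m : ℝ) ^ 2 * (a * b) * (P * R) ≤ 1 * (P * R) :=
      mul_le_mul_of_nonneg_right h3 (by positivity)
    calc (m : ℝ) ^ 2 = (m : ℝ) ^ 2 * (a * b * (P * R)) := by rw [h1, mul_one]
      _ ≤ P * R := by linarith
  have h5 : (P - 1) * (R - 1) = P * R * (1 - a - b) + 1 := by
    rw [ha, hb]
    field_simp
    ring
  have h6 : 0 ≤ 1 - 2 / (m : ℝ) := by
    rw [sub_nonneg, div_le_one hm0]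
    exact hm2
  have h7 : (m : ℝ) ^ 2 * (1 - 2 / m) ≤ P * R * (1 - a - b) :=
    mul_le_mul hprod (by linarith) h6 (by positivity)
  have h8 : (m : ℝ) ^ 2 * (1 - 2 / m) = (m : ℝ) ^ 2 - 2 * m := by
    field_simp
  linarith

/-- The tail estimate holds only for levels m ≤ K/2; restricting to them costs at most 1. -/
lemma harmonicSum_half (K : ℕ) : harmonicSum K - 1 ≤ harmonicSum (K / 2) := by
  have h : harmonicSum K = harmonicSum (K / 2) +
      ∑ k ∈ Finset.Ico (K / 2) K, 1 / ((k : ℝ) + 1) := by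
    rw [harmonicSum, harmonicSum, Finset.sum_range_add_sum_Ico _ (Nat.div_le_self K 2)]
  have h2 : ∑ k ∈ Finset.Ico (K / 2) K, 1 / ((k : ℝ) + 1) ≤
      ∑ _k ∈ Finset.Ico (K / 2) K, 1 / (((K / 2 : ℕ) : ℝ) + 1) := by
    refine Finset.sum_le_sum fun k hk => ?_
    have : ((K / 2 : ℕ) : ℝ) ≤ k := by exact_mod_cast (Finset.mem_Ico.1 hk).1
    gcongr
  rw [Finset.sum_const, Nat.card_Ico, nsmul_eq_mul, mul_one_div] at h2
  have h3 : ((K - K / 2 : ℕ) : ℝ) / (((K / 2 : ℕ) : ℝ) + 1) ≤ 1 := by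
    rw [div_le_one (by positivity)]
    exact_mod_cast (by omega : K - K / 2 ≤ K / 2 + 1)
  linarith

/-- The layers between consecutive levels that lie below `d` are disjoint parts of [0, d]. -/
lemma sum_levels_le {s : ℕ → ℝ} (hs : Antitone s) (hs0 : ∀ m, 0 ≤ s m) {d : ℝ} (hd : 0 ≤ d)
    (M : ℕ) :
    ∑ m ∈ Finset.range M, (s m - s (m + 1)) * (if s m ≤ d then 1 else 0) ≤ d := by
  have h : ∀ m ∈ Finset.range M, (s m - s (m + 1)) * (if s m ≤ d then 1 else 0) ≤
      min d (s m) - min d (s (m + 1)) := fun m _ => by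
    have h1 := hs m.le_succ
    split_ifs with hsd
    · rw [min_eq_right hsd, min_eq_right (h1.trans hsd), mul_one]
    · simpa using min_le_min (le_refl d) h1
  refine (Finset.sum_le_sum h).trans ?_
  rw [Finset.sum_range_sub' (fun m => min d (s m))]
  linarith [min_le_left d (s 0), le_min hd (hs0 M)]

/-- A layer-cake bound for a finite family with tail `#{d ≥ 2 / m ^ 2} ≥ m ^ 2 - 2 * m`. -/
lemma le_sum_of_tail_bound {ι : Type*} [Fintype ι] (d : ι → ℝ) (hd : ∀ a, 0 ≤ d a) (M : ℕ)
    (h : ∀ m : ℕ, 2 ≤ m → m ≤ M → (m : ℝ) ^ 2 - 2 * m ≤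
      ((Finset.univ.filter fun a => 2 / (m : ℝ) ^ 2 ≤ d a).card : ℝ)) :
    4 * harmonicSum M - 14 ≤ ∑ a, d a := by
  set s : ℕ → ℝ := fun m => 2 / ((m : ℝ) + 1) ^ 2 with hs
  have hanti : Antitone s := fun k l hkl => by simp only [hs]; gcongr
  have hs0 : ∀ m, 0 ≤ s m := fun m => by simp only [hs]; positivity
  have h1 := Finset.sum_le_sum fun a (_ : a ∈ Finset.univ) => sum_levels_le hanti hs0 (hd a) M
  refine le_trans ?_ h1
  rw [Finset.sum_comm]
  have h2 : ∀ m ∈ Finset.range M,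
      4 * (1 / ((m : ℝ) + 1)) - 14 * (1 / ((m : ℝ) + 1) - 1 / (((m + 1 : ℕ) : ℝ) + 1)) ≤
      ∑ a, (s m - s (m + 1)) * (if s m ≤ d a then 1 else 0) := by
    intro m hm
    rw [← Finset.mul_sum, ← Finset.sum_filter, Finset.sum_const, nsmul_eq_mul, mul_one]
    have h3 : ((m : ℝ) + 1) ^ 2 - 2 * (m + 1) ≤
        ((Finset.univ.filter fun a => s m ≤ d a).card : ℝ) := by
      rcases Nat.eq_zero_or_pos m with h0 | h0
      · subst h0
        refine le_trans ?_ (Nat.cast_nonneg _)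
        norm_num
      · have := h (m + 1) (by omega) (Finset.mem_range.1 hm)
        push_cast at this
        exact this
    refine le_trans ?_ (mul_le_mul_of_nonneg_left h3 (sub_nonneg.2 (hanti m.le_succ)))
    simp only [hs]
    push_cast
    have hm0 : (0 : ℝ) ≤ m := m.cast_nonneg
    rw [← sub_nonneg]
    -- Each layer contributes 4/(m+1) minus a telescoping error, whose coefficient 14 makes the
    -- remainder positive.
    have : (2 / ((m : ℝ) + 1) ^ 2 - 2 / ((m : ℝ) + 1 + 1) ^ 2) *
        (((m : ℝ) + 1) ^ 2 - 2 * (m + 1)) -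
        (4 * (1 / ((m : ℝ) + 1)) - 14 * (1 / ((m : ℝ) + 1) - 1 / ((m : ℝ) + 1 + 1))) =
        6 / (((m : ℝ) + 1) * (m + 1 + 1) ^ 2) := by
      field_simp
      ring
    rw [this]
    positivity
  refine le_trans ?_ (Finset.sum_le_sum h2)
  rw [Finset.sum_sub_distrib, ← Finset.mul_sum, ← Finset.mul_sum,
    Finset.sum_range_sub' (fun m : ℕ => 1 / ((m : ℝ) + 1))]
  have : (0 : ℝ) ≤ 1 / ((M : ℝ) + 1) := by positivity
  simp only [harmonicSum, Nat.cast_zero, zero_add, div_one]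
  linarith

/-! ### Delay of a pair, by comparison with a reference run. -/

/-- The instance whose job `i` has size `1 / (u i + 1) ^ 2`. For uniformly random `u` these are the
hard instances. -/
noncomputable def hardInstance {n K : ℕ} (u : Fin n → Fin K) : Instance n :=
  ⟨fun i => jobSize (u i), fun _ => jobSize_pos _⟩

section Pair

variable {n B K : ℕ}

/-- Two jobs delay each other at least by the processing that they received at a time when neither
of them can yet be told apart from its counterpart in a reference run with maximal sizes. -/
lemma work_add_work_le_pairDelay_run (D : DeterministicAlgorithm n B) (σ : Equiv.Perm (Fin n))
    (u v : Fin n → Fin K) {i j : Fin n}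
    (hdiff : ∀ m, u m ≠ v m → (m = i ∨ m = j) ∧ (u m : ℕ) = 0 ∧ ¬ (σ.symm m : ℕ) < B)
    (hfi : (D.run σ (hardInstance v)).completionTime i ≠ ⊤)
    (hfj : (D.run σ (hardInstance v)).completionTime j ≠ ⊤) {T : ℝ} (hT : 0 ≤ T)
    (hi : (D.run σ (hardInstance u)).work i T < jobSize (v i))
    (hj : (D.run σ (hardInstance u)).work j T < jobSize (v j)) :
    (D.run σ (hardInstance u)).work i T + (D.run σ (hardInstance u)).work j T ≤
      (D.run σ (hardInstance v)).pairDelay i j := by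
  have agree := D.nonanticipating σ (hardInstance u) (hardInstance v) T hT
    (fun k hk => by
      by_contra hne
      have huv : u (σ k) ≠ v (σ k) := fun h => hne (by simp [hardInstance, h])
      exact (hdiff _ huv).2.2 (by simpa using hk))
    (fun m hm => by
      have huv : u m ≠ v m := fun h => hm (by simp [hardInstance, h])
      obtain ⟨hmij, h0, -⟩ := hdiff m huv
      have hlt : (D.run σ (hardInstance u)).work m T < jobSize (v m) := by
        rcases hmij with rfl | rfl
        · exact hi
        · exact hj
      refine ⟨hlt.trans_le ?_, hlt⟩
      exact jobSize_antitone (by rw [h0]; exact Nat.zero_le _))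
  rw [agree i T hT le_rfl] at hi ⊢
  rw [agree j T hT le_rfl] at hj ⊢
  exact Schedule.work_add_work_le_pairDelay _ hfi hfj hT hi hj

/-- In use, `S` is the reference run, `a` the actual size of `i`, and `d` the delay in the actual
run. If `i` is still below `a` when `j` completes, let `T` increase to that completion; otherwise
let it increase to the moment when `i` reaches `a`. -/
lemma Schedule.min_add_ite_le {x : Instance n} (S : Schedule x) {i j : Fin n}
    (hfj : S.completionTime j ≠ ⊤) {a d : ℝ} (hd : 0 ≤ d)
    (h : ∀ T, 0 ≤ T → S.work i T < a → S.work j T < x.1 j → S.work i T + S.work j T ≤ d) :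
    min a (S.work i (S.finish j)) + (if S.work i (S.finish j) < a then x.1 j else 0) ≤ d := by
  have hC0 := S.finish_nonneg j
  have hwC := S.work_finish hfj
  have hCpos : 0 < S.finish j := by
    refine hC0.lt_of_ne fun h0 => ?_
    rw [← h0, S.work_zero] at hwC
    exact (x.2 j).ne hwC
  set C := S.finish j with hC
  split_ifs with hlt
  · rw [min_eq_right hlt.le]
    refine le_of_forall_pos_le_add fun ε hε => ?_
    set T := max 0 (C - ε / 2) with hT
    have hT0 : 0 ≤ T := le_max_left _ _
    have hTC : T < C := max_lt hCpos (by linarith)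
    have hTε : C - ε / 2 ≤ T := le_max_right _ _
    have h1 := h T hT0 ((S.work_mono i _ _ hT0 hTC.le).trans_lt hlt)
      (S.work_lt_of_lt_finish hT0 hTC)
    have h2 := S.work_sub_le i hT0 hTC.le
    have h3 := S.work_sub_le j hT0 hTC.le
    linarith
  · rw [not_lt] at hlt
    rw [min_eq_left hlt, add_zero]
    refine le_of_forall_lt_imp_le_of_dense fun s hs => ?_
    rcases lt_or_ge s 0 with hs0 | hs0
    · linarith
    obtain ⟨T, ⟨hT0, hTC⟩, rfl⟩ := intermediate_value_Icc hC0
      ((S.continuousOn_work i).mono Set.Icc_subset_Ici_self)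
      (show s ∈ Set.Icc (S.work i 0) (S.work i C) from
        ⟨by rwa [S.work_zero], hs.le.trans hlt⟩)
    have hTC' : T < C := by
      refine hTC.lt_of_ne fun he => ?_
      rw [he] at hs
      linarith
    have h1 := h T hT0 hs (S.work_lt_of_lt_finish hT0 hTC')
    linarith [S.work_nonneg j hT0]

variable (D : DeterministicAlgorithm n B) (σ : Equiv.Perm (Fin n))

lemma le_sum_pairDelay_unknown_known
    (hfin : ∀ (u : Fin n → Fin K) i, (D.run σ (hardInstance u)).completionTime i ≠ ⊤)
    (u : Fin n → Fin K) {i j : Fin n} (hij : i ≠ j) (hi : ¬ (σ.symm i : ℕ) < B) (l : Fin K) :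
    2 * √2 / ((l : ℝ) + 1) - 9 / ((l : ℝ) + 1) ^ 2 - 9 / K ≤
      ∑ k, (D.run σ (hardInstance (Function.update (Function.update u i k) j l))).pairDelay i j := by
  set z : Fin K := ⟨0, l.pos⟩ with hz
  set v : Fin K → Fin n → Fin K := fun k => Function.update (Function.update u i k) j l with hv
  have hvi : ∀ k, v k i = k := fun k => by simp [hv, hij]
  have hvj : ∀ k, v k j = l := fun k => by simp [hv]
  have hvm : ∀ k m, m ≠ i → v k m = v z m := fun k m hm => by
    by_cases hmj : m = j
    · subst hmj; simp [hv]
    · simp [hv, hm, hmj]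
  set S := D.run σ (hardInstance (v z)) with hS
  have hb := le_sum_min_add_ite (K := K) (l := (l : ℝ) + 1) (by simp)
    (by exact_mod_cast l.2) (S.work_nonneg i (S.finish_nonneg j))
  refine hb.trans (Finset.sum_le_sum fun k _ => ?_)
  have hxj : (hardInstance (v z)).1 j = 1 / ((l : ℝ) + 1) ^ 2 := by
    simp only [hardInstance, hvj, jobSize]
  have := S.min_add_ite_le (i := i) (j := j) (hfin _ _) (a := jobSize k)
    (Schedule.pairDelay_nonneg (D.run σ (hardInstance (v k))) i j) fun T hT h1 h2 => by
      refine work_add_work_le_pairDelay_run D σ (v z) (v k) (fun m hm => ?_) (hfin _ _)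
        (hfin _ _) hT (by rwa [hvi]) (by rw [hvj]; rw [hxj] at h2; exact h2)
      have hmi : m = i := by
        by_contra hmi
        exact hm (hvm k m hmi).symm
      subst hmi
      exact ⟨Or.inl rfl, by rw [hvi], hi⟩
  rwa [hxj] at this

lemma le_sum_pairDelay_unknown_unknown
    (hfin : ∀ (u : Fin n → Fin K) i, (D.run σ (hardInstance u)).completionTime i ≠ ⊤)
    (u : Fin n → Fin K) {i j : Fin n} (hij : i ≠ j) (hi : ¬ (σ.symm i : ℕ) < B)
    (hj : ¬ (σ.symm j : ℕ) < B) (hK : 0 < K) :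
    4 * harmonicSum K - 18 ≤ ∑ k, ∑ l,
      (D.run σ (hardInstance (Function.update (Function.update u i k) j l))).pairDelay i j := by
  set z : Fin K := ⟨0, hK⟩ with hz
  set v : Fin K → Fin K → Fin n → Fin K :=
    fun k l => Function.update (Function.update u i k) j l with hv
  have hvi : ∀ k l, v k l i = k := fun k l => by simp [hv, hij]
  have hvj : ∀ k l, v k l j = l := fun k l => by simp [hv]
  have hvm : ∀ k l m, m ≠ i → m ≠ j → v k l m = v z z m := fun k l m hm hmj => by
    simp [hv, hm, hmj]
  set S := D.run σ (hardInstance (v z z)) with hS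
  have hA : ∀ (k l : Fin K) (T : ℝ), 0 ≤ T → S.work i T < jobSize k → S.work j T < jobSize l →
      S.work i T + S.work j T ≤ (D.run σ (hardInstance (v k l))).pairDelay i j := by
    intro k l T hT h1 h2
    refine work_add_work_le_pairDelay_run D σ (v z z) (v k l) (fun m hm => ?_) (hfin _ _)
        (hfin _ _) hT (by rwa [hvi]) (by rwa [hvj])
    by_cases hmi : m = i
    · subst hmi
      exact ⟨Or.inl rfl, by rw [hvi], hi⟩
    · by_cases hmj : m = j
      · subst hmj
        exact ⟨Or.inr rfl, by rw [hvj], hj⟩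
      · exact absurd (hvm k l m hmi hmj).symm hm
  have hmain := le_sum_of_tail_bound
    (fun a : Fin K × Fin K => (D.run σ (hardInstance (v a.1 a.2))).pairDelay i j)
    (fun a => Schedule.pairDelay_nonneg _ i j) (K / 2) ?_
  · rw [Fintype.sum_prod_type] at hmain
    linarith [harmonicSum_half K]
  intro m hm2 hmK
  have hm : (2 : ℝ) ≤ m := by exact_mod_cast hm2
  have hCi := S.finish_nonneg i
  have hwi : S.work i (S.finish i) = 1 := by
    rw [S.work_finish (hfin _ _)]
    simp [hardInstance, hvi, hz, jobSize_zero]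
  -- A time at which the pair has received exactly 2/m² in total; it exists because `i` alone
  -- receives 1 in the reference run.
  obtain ⟨T, ⟨hT0, -⟩, hT⟩ := intermediate_value_Icc (f := fun t => S.work i t + S.work j t) hCi
    (((S.continuousOn_work i).add (S.continuousOn_work j)).mono Set.Icc_subset_Ici_self)
    (show 2 / (m : ℝ) ^ 2 ∈ Set.Icc (S.work i 0 + S.work j 0)
        (S.work i (S.finish i) + S.work j (S.finish i)) from by
      constructor
      · rw [S.work_zero, S.work_zero, add_zero]
        positivity
      · have : 2 / (m : ℝ) ^ 2 ≤ 1 := by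
          rw [div_le_one (by positivity)]
          nlinarith
        linarith [S.work_nonneg j hCi])
  refine (le_sizeCount_mul_sizeCount (K := K) hm2 (by omega) (S.work_nonneg i hT0)
    (S.work_nonneg j hT0) hT).trans ?_
  rw [sizeCount, sizeCount, ← Nat.cast_mul, ← Finset.card_product]
  refine Nat.cast_le.2 (Finset.card_le_card fun a ha => ?_)
  simp only [Finset.mem_product, Finset.mem_filter, Finset.mem_univ, true_and] at ha ⊢
  rw [← hT]
  exact hA a.1 a.2 T hT0 ha.1 ha.2

/-! ### Summation over all hard instances. -/

/-- Resampling a coordinate preserves the uniform law: exchanging it with the fresh value is an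
involution on pairs. -/
lemma sum_sum_update (i : Fin n) (f : (Fin n → Fin K) → ℝ) :
    ∑ u : Fin n → Fin K, ∑ k, f (Function.update u i k) = K * ∑ u, f u := by
  have h : ∑ a : (Fin n → Fin K) × Fin K, f (Function.update a.1 i a.2) =
      ∑ a : (Fin n → Fin K) × Fin K, f a.1 :=
    Finset.sum_nbij' (fun a => (Function.update a.1 i a.2, a.1 i))
      (fun a => (Function.update a.1 i a.2, a.1 i)) (by simp) (by simp) (by simp) (by simp)
      (by simp)
  rw [Fintype.sum_prod_type, Fintype.sum_prod_type] at h
  rw [h, Finset.mul_sum]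
  simp

lemma sum_sum_sum_update (i j : Fin n) (f : (Fin n → Fin K) → ℝ) :
    ∑ u : Fin n → Fin K, ∑ k, ∑ l, f (Function.update (Function.update u i k) j l) =
      (K : ℝ) ^ 2 * ∑ u, f u := by
  rw [sum_sum_update i (fun u => ∑ l, f (Function.update u j l)), sum_sum_update]
  ring

lemma pow_mul_le_of_le_sum_update (i j : Fin n) (f : (Fin n → Fin K) → ℝ) {c : ℝ}
    (h : ∀ u, c ≤ ∑ k, ∑ l, f (Function.update (Function.update u i k) j l)) :
    (K : ℝ) ^ n * c ≤ (K : ℝ) ^ 2 * ∑ u, f u := by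
  rw [← sum_sum_sum_update i j]
  have := Finset.card_nsmul_le_sum (Finset.univ : Finset (Fin n → Fin K)) _ c fun u _ => h u
  simpa using this

/-- The indicator of a job being known from the start. -/
noncomputable def knownIndicator (B : ℕ) (σ : Equiv.Perm (Fin n)) (i : Fin n) : ℝ :=
  if (σ.symm i : ℕ) < B then 1 else 0

/-- The asymptotic expected delay of a pair of jobs, by the indicators of their being known. -/
noncomputable def pairWeight (a b : ℝ) : ℝ :=
  2 * (a * b) + 2 * √2 * (a * (1 - b) + (1 - a) * b) + 4 * ((1 - a) * (1 - b))

lemma le_sum_pairDelay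
    (hfin : ∀ (u : Fin n → Fin K) i, (D.run σ (hardInstance u)).completionTime i ≠ ⊤)
    (hK : 0 < K) (i j : Fin n) :
    (K : ℝ) ^ n * (pairWeight (knownIndicator B σ i) (knownIndicator B σ j) * harmonicSum K - 27 -
        if i = j then 4 * harmonicSum K else 0) ≤
      (K : ℝ) ^ 2 * ∑ u : Fin n → Fin K, (D.run σ (hardInstance u)).pairDelay i j := by
  have hH := harmonicSum_nonneg K
  have mixed : ∀ i j : Fin n, i ≠ j → ¬ (σ.symm i : ℕ) < B →
      (K : ℝ) ^ n * (2 * √2 * harmonicSum K - 27) ≤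
        (K : ℝ) ^ 2 * ∑ u : Fin n → Fin K, (D.run σ (hardInstance u)).pairDelay i j := fun i j hij hi =>
    pow_mul_le_of_le_sum_update i j (fun u => (D.run σ (hardInstance u)).pairDelay i j)
      fun u => by
        rw [Finset.sum_comm]
        exact (sum_threshold_bound K).trans (Finset.sum_le_sum fun l _ =>
          le_sum_pairDelay_unknown_known D σ hfin u hij hi l)
  have hr : √2 ≤ 2 := by
    rw [Real.sqrt_le_left (by norm_num)]
    norm_num
  by_cases hij : i = j
  · subst hij
    rw [if_pos rfl]
    have h0 : 0 ≤ (K : ℝ) ^ 2 * ∑ u : Fin n → Fin K,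
        (D.run σ (hardInstance u)).pairDelay i i :=
      mul_nonneg (by positivity)
        (Finset.sum_nonneg fun u _ => Schedule.pairDelay_nonneg _ i i)
    -- On the diagonal the correction 4H makes the left side nonpositive, since the weight is at
    -- most 4.
    refine (mul_nonpos_of_nonneg_of_nonpos (by positivity) ?_).trans h0
    have : pairWeight (knownIndicator B σ i) (knownIndicator B σ i) ≤ 4 := by
      unfold pairWeight knownIndicator
      split_ifs <;> norm_num
    nlinarith
  rw [if_neg hij, sub_zero]
  by_cases hi : (σ.symm i : ℕ) < B <;> by_cases hj : (σ.symm j : ℕ) < B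
  · have hw : pairWeight (knownIndicator B σ i) (knownIndicator B σ j) = 2 := by
      simp [pairWeight, knownIndicator, hi, hj]
    rw [hw]
    refine pow_mul_le_of_le_sum_update i j
      (fun u => (D.run σ (hardInstance u)).pairDelay i j) fun u => ?_
    have h1 : ∑ k : Fin K, ∑ l : Fin K, min (jobSize k) (jobSize l) ≤ ∑ k, ∑ l,
        (D.run σ (hardInstance
          (Function.update (Function.update u i k) j l))).pairDelay i j := by
      refine Finset.sum_le_sum fun k _ => Finset.sum_le_sum fun l _ => ?_
      have := Schedule.min_le_pairDelay (D.run σ (hardInstance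
        (Function.update (Function.update u i k) j l))) (hfin _ i) (hfin _ j)
      simpa [hardInstance, hij] using this
    linarith [le_sum_min_jobSize K]
  · have hw : pairWeight (knownIndicator B σ i) (knownIndicator B σ j) = 2 * √2 := by
      simp [pairWeight, knownIndicator, hi, hj]
    rw [hw]
    simp only [Schedule.pairDelay_comm _ i j]
    exact mixed j i (Ne.symm hij) hj
  · have hw : pairWeight (knownIndicator B σ i) (knownIndicator B σ j) = 2 * √2 := by
      simp [pairWeight, knownIndicator, hi, hj]
    rw [hw]
    exact mixed i j hij hi
  · have hw : pairWeight (knownIndicator B σ i) (knownIndicator B σ j) = 4 := by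
      simp [pairWeight, knownIndicator, hi, hj]
    rw [hw]
    refine pow_mul_le_of_le_sum_update i j
      (fun u => (D.run σ (hardInstance u)).pairDelay i j) fun u => ?_
    have := le_sum_pairDelay_unknown_unknown D σ hfin u hij hi hj hK
    linarith

lemma sum_knownIndicator (hB : B ≤ n) : ∑ i, knownIndicator B σ i = B := by
  rw [← Equiv.sum_comp σ]
  simp only [knownIndicator, Equiv.symm_apply_apply]
  rw [Fin.sum_univ_eq_sum_range (fun r => if r < B then (1 : ℝ) else 0) n, ← Finset.sum_filter]
  have : (Finset.range n).filter (· < B) = Finset.range B := by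
    ext r
    simp only [Finset.mem_filter, Finset.mem_range]
    omega
  simp [this]

lemma sum_pairWeight (hB : B ≤ n) :
    ∑ i, ∑ j, pairWeight (knownIndicator B σ i) (knownIndicator B σ j) =
      2 * (B : ℝ) ^ 2 + 4 * √2 * (B * (n - B)) + 4 * ((n : ℝ) - B) ^ 2 := by
  have h1 := sum_knownIndicator σ hB
  have h2 : ∑ i, (1 - knownIndicator B σ i) = (n : ℝ) - B := by
    rw [Finset.sum_sub_distrib, h1]
    simp
  unfold pairWeight
  simp only [Finset.sum_add_distrib, ← Finset.mul_sum, ← Finset.sum_mul, h1, h2]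
  ring

lemma le_sum_sum_finish
    (hfin : ∀ (u : Fin n → Fin K) i, (D.run σ (hardInstance u)).completionTime i ≠ ⊤)
    (hK : 0 < K) (hB : B ≤ n) :
    (K : ℝ) ^ n * (harmonicSum K * (2 * (B : ℝ) ^ 2 + 4 * √2 * (B * (n - B)) +
        4 * ((n : ℝ) - B) ^ 2) - 27 * (n : ℝ) ^ 2 - 4 * n * harmonicSum K) ≤
      2 * (K : ℝ) ^ 2 * ∑ u : Fin n → Fin K, ∑ i, (D.run σ (hardInstance u)).finish i := by
  have h1 := Finset.sum_le_sum fun i (_ : i ∈ Finset.univ) =>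
    Finset.sum_le_sum fun j (_ : j ∈ Finset.univ) => le_sum_pairDelay D σ hfin hK i j
  have h2 := Finset.sum_le_sum fun u (_ : u ∈ (Finset.univ : Finset (Fin n → Fin K))) =>
    (D.run σ (hardInstance u)).sum_pairDelay_le
  simp only [← Finset.mul_sum, Finset.sum_sub_distrib, ← Finset.sum_mul, sum_pairWeight σ hB] at h1
  have h3 : ∑ i, ∑ j, ∑ u : Fin n → Fin K, (D.run σ (hardInstance u)).pairDelay i j =
      ∑ u : Fin n → Fin K, ∑ i, ∑ j, (D.run σ (hardInstance u)).pairDelay i j := by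
    rw [Finset.sum_comm]
    simp only [Finset.sum_comm (s := (Finset.univ : Finset (Fin n → Fin K)))]
    rw [Finset.sum_comm]
  rw [h3] at h1
  rw [← Finset.mul_sum] at h2
  have h4 := mul_le_mul_of_nonneg_left h2 (sq_nonneg (K : ℝ))
  simp only [Finset.sum_const, Finset.card_univ, Fintype.card_fin, nsmul_eq_mul, Finset.sum_ite_eq,
    Finset.mem_univ, if_true] at h1
  refine le_trans (le_of_eq ?_) (h1.trans (by linarith))
  ring

end Pair

/-! ### From deterministic to randomized algorithms. -/

section Average

variable {n B K : ℕ}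

lemma DeterministicAlgorithm.le_sum_cost (D : DeterministicAlgorithm n B)
    (σ : Equiv.Perm (Fin n)) (hK : 0 < K) (hB : B ≤ n) :
    ENNReal.ofReal ((K : ℝ) ^ n / (2 * (K : ℝ) ^ 2) *
      (harmonicSum K * (2 * (B : ℝ) ^ 2 + 4 * √2 * (B * (n - B)) +
        4 * ((n : ℝ) - B) ^ 2) - 27 * (n : ℝ) ^ 2 - 4 * n * harmonicSum K)) ≤
      ∑ u : Fin n → Fin K, (D.run σ (hardInstance u)).cost := by
  by_cases hfin : ∀ (u : Fin n → Fin K) i, (D.run σ (hardInstance u)).completionTime i ≠ ⊤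
  · have hK0 : (0 : ℝ) < K := by exact_mod_cast hK
    rw [Finset.sum_congr rfl fun u _ => Schedule.cost_eq_ofReal _ (hfin u),
      ← ENNReal.ofReal_sum_of_nonneg fun u _ =>
        Finset.sum_nonneg fun i _ => Schedule.finish_nonneg _ i]
    refine ENNReal.ofReal_le_ofReal ?_
    rw [div_mul_eq_mul_div, div_le_iff₀ (by positivity), mul_comm (∑ _, _)]
    exact le_sum_sum_finish D σ hfin hK hB
  -- A job that is never completed makes the total cost infinite.
  · push Not at hfin
    obtain ⟨u, i, hui⟩ := hfin
    have h1 : (D.run σ (hardInstance u)).cost = ⊤ :=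
      ENNReal.sum_eq_top.2 ⟨i, Finset.mem_univ i, hui⟩
    have h2 : ∑ u : Fin n → Fin K, (D.run σ (hardInstance u)).cost = ⊤ :=
      ENNReal.sum_eq_top.2 ⟨u, Finset.mem_univ u, h1⟩
    rw [h2]
    exact le_top

/-- The easy direction of Yao's principle: a bound on the sum for every seed and permutation
survives averaging over both. -/
lemma RandomizedAlgorithm.le_sum_expectedCost (A : RandomizedAlgorithm n B) {ι : Type*}
    [Fintype ι] (x : ι → Instance n) {c : ℝ≥0∞}
    (h : ∀ (D : DeterministicAlgorithm n B) (σ : Equiv.Perm (Fin n)),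
      c ≤ ∑ u, (D.run σ (x u)).cost) :
    c ≤ ∑ u, A.expectedCost (x u) := by
  let := A.measurableSpace
  have := A.isProbabilityMeasure
  have hσ : ∀ σ : Equiv.Perm (Fin n),
      c ≤ ∑ u, ∫⁻ ω, ((A.alg ω).run σ (x u)).cost ∂A.P := by
    intro σ
    rw [← lintegral_finsetSum _ fun u _ => A.measurable_cost σ (x u)]
    calc c = ∫⁻ _, c ∂A.P := by simp
      _ ≤ _ := lintegral_mono fun ω => h (A.alg ω) σ
  unfold RandomizedAlgorithm.expectedCost
  simp only [div_eq_mul_inv]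
  rw [← Finset.sum_mul, Finset.sum_comm, ← div_eq_mul_inv,
    ENNReal.le_div_iff_mul_le (Or.inl (by simp))
      (Or.inl (ENNReal.natCast_ne_top _))]
  have := Finset.card_nsmul_le_sum Finset.univ _ c fun σ (_ : σ ∈ Finset.univ) => hσ σ
  rwa [nsmul_eq_mul, mul_comm, Finset.card_univ] at this

lemma sum_sum_min_hardInstance_le (i j : Fin n) :
    (K : ℝ) ^ 2 * ∑ u : Fin n → Fin K, min ((hardInstance u).1 i) ((hardInstance u).1 j) ≤
      (K : ℝ) ^ n * (2 * harmonicSum K + if i = j then (K : ℝ) ^ 2 else 0) := by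
  have hH := harmonicSum_nonneg K
  by_cases hij : i = j
  · subst hij
    rw [if_pos rfl]
    have h1 : ∑ u : Fin n → Fin K, min ((hardInstance u).1 i) ((hardInstance u).1 i) ≤
        (K : ℝ) ^ n := by
      refine (Finset.sum_le_card_nsmul _ _ 1 fun u _ => ?_).trans (by simp)
      rw [min_self]
      exact jobSize_le_one _
    have h2 : 0 ≤ (K : ℝ) ^ n * (2 * harmonicSum K) := by positivity
    have h3 := mul_le_mul_of_nonneg_left h1 (sq_nonneg (K : ℝ))
    linarith
  · rw [if_neg hij, add_zero, ← sum_sum_sum_update i j]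
    refine (Finset.sum_le_card_nsmul _ _ (2 * harmonicSum K) fun u _ => ?_).trans (by simp)
    refine le_trans (le_of_eq ?_) (sum_min_jobSize_le K)
    simp [hardInstance, hij]

lemma sum_opt_hardInstance_le (hK : 0 < K) :
    ∑ u : Fin n → Fin K, opt (hardInstance u) ≤
      ENNReal.ofReal ((K : ℝ) ^ n / (K : ℝ) ^ 2 *
        (harmonicSum K * (n : ℝ) ^ 2 + (K : ℝ) ^ 2 * n)) := by
  have hK0 : (0 : ℝ) < K := by exact_mod_cast hK
  refine (Finset.sum_le_sum fun u _ => opt_le (hardInstance u)).trans ?_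
  rw [← ENNReal.ofReal_sum_of_nonneg fun u _ => add_nonneg
    (mul_nonneg (by norm_num) (Finset.sum_nonneg fun i _ => Finset.sum_nonneg fun j _ =>
      le_min ((hardInstance u).2 i).le ((hardInstance u).2 j).le))
    (mul_nonneg (by norm_num) (Finset.sum_nonneg fun i _ => ((hardInstance u).2 i).le))]
  refine ENNReal.ofReal_le_ofReal ?_
  rw [div_mul_eq_mul_div, le_div_iff₀ (by positivity), Finset.sum_add_distrib, ← Finset.mul_sum,
    ← Finset.mul_sum]
  have h1 := Finset.sum_le_sum fun i (_ : i ∈ Finset.univ) =>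
    Finset.sum_le_sum fun j (_ : j ∈ Finset.univ) =>
      sum_sum_min_hardInstance_le (n := n) (K := K) i j
  have h2 : ∑ i, ∑ j, ∑ u : Fin n → Fin K, min ((hardInstance u).1 i) ((hardInstance u).1 j) =
      ∑ u : Fin n → Fin K, ∑ i, ∑ j, min ((hardInstance u).1 i) ((hardInstance u).1 j) := by
    simp only [Finset.sum_comm (s := (Finset.univ : Finset (Fin n)))
      (t := (Finset.univ : Finset (Fin n → Fin K)))]
  simp only [← Finset.mul_sum, h2, Finset.sum_add_distrib, Finset.sum_const, Finset.card_univ,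
    Fintype.card_fin, nsmul_eq_mul, Finset.sum_ite_eq, Finset.mem_univ, if_true] at h1
  have h3 : ∑ u : Fin n → Fin K, ∑ i, (hardInstance u).1 i ≤ (K : ℝ) ^ n * n := by
    refine (Finset.sum_le_card_nsmul _ _ (n : ℝ) fun u _ => ?_).trans (by simp)
    refine (Finset.sum_le_card_nsmul _ _ (1 : ℝ) fun i _ => ?_).trans (by simp)
    exact jobSize_le_one _
  have h4 := mul_le_mul_of_nonneg_left h3 (sq_nonneg (K : ℝ))
  linarith

/-- A bound on every ratio also bounds the ratio of the sums over all hard instances, so numerator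
and denominator are estimated separately. -/
lemma RandomizedAlgorithm.le_of_ratio_le (A : RandomizedAlgorithm n B) (hB : B ≤ n) {r : ℝ}
    (hr : 0 ≤ r) (h : A.ratio ≤ ENNReal.ofReal r) (hK : 0 < K) :
    harmonicSum K * (2 * (B : ℝ) ^ 2 + 4 * √2 * (B * (n - B)) + 4 * ((n : ℝ) - B) ^ 2) -
        27 * (n : ℝ) ^ 2 - 4 * n * harmonicSum K ≤
      2 * r * (harmonicSum K * (n : ℝ) ^ 2 + (K : ℝ) ^ 2 * n) := by
  have hK0 : (0 : ℝ) < K := by exact_mod_cast hK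
  have hH := harmonicSum_nonneg K
  have h1 := A.le_sum_expectedCost (fun u : Fin n → Fin K => hardInstance u)
    fun D σ => D.le_sum_cost σ hK hB
  have h2 : ∀ x : Instance n, A.expectedCost x ≤ ENNReal.ofReal r * opt x := by
    intro x
    have hx : opt x ≠ ⊤ := ((opt_le x).trans_lt ENNReal.ofReal_lt_top).ne
    rw [← ENNReal.div_le_iff_le_mul (Or.inr ENNReal.ofReal_ne_top) (Or.inl hx)]
    exact (le_iSup (fun x => A.expectedCost x / opt x) x).trans h
  have h3 := h1.trans (Finset.sum_le_sum fun u _ => h2 _)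
  rw [← Finset.mul_sum] at h3
  have h4 := h3.trans (mul_le_mul_right (sum_opt_hardInstance_le hK) _)
  rw [← ENNReal.ofReal_mul hr, ENNReal.ofReal_le_ofReal_iff (by positivity)] at h4
  have hc : 0 < (K : ℝ) ^ n / (2 * (K : ℝ) ^ 2) := by positivity
  refine le_of_mul_le_mul_left (h4.trans (le_of_eq ?_)) hc
  field_simp

end Average

/-! ### The limits in the number of jobs and in the number of sizes. -/

lemma tendsto_harmonicSum : Tendsto harmonicSum atTop atTop :=
  Real.tendsto_sum_range_one_div_nat_succ_atTop

/-- Dividing by `n ^ 2` and letting the number of jobs tend to infinity. -/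
lemma harmonicSum_mul_le_of_ratio_le {w : ℝ} {B : ℕ → ℕ} (hBn : ∀ n, 2 ≤ n → B n ≤ n)
    (hB : Tendsto (fun n : ℕ => (B n : ℝ) / n) atTop (nhds w))
    (A : (n b : ℕ) → RandomizedAlgorithm n b) {r : ℝ} (hr : 0 ≤ r)
    (h : ∀ n, 2 ≤ n → (A n (B n)).ratio ≤ ENNReal.ofReal r) {K : ℕ} (hK : 0 < K) :
    harmonicSum K * (2 * w ^ 2 + 4 * √2 * (w * (1 - w)) + 4 * (1 - w) ^ 2) - 27 ≤
      2 * r * harmonicSum K := by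
  set H := harmonicSum K
  have hinv : Tendsto (fun n : ℕ => ((n : ℝ))⁻¹) atTop (nhds 0) :=
    tendsto_inv_atTop_nhds_zero_nat
  have hl : Tendsto (fun n : ℕ => H * (2 * ((B n : ℝ) / n) ^ 2 +
      4 * √2 * ((B n : ℝ) / n * (1 - (B n : ℝ) / n)) + 4 * (1 - (B n : ℝ) / n) ^ 2) - 27 -
        4 * H * ((n : ℝ))⁻¹) atTop
      (nhds (H * (2 * w ^ 2 + 4 * √2 * (w * (1 - w)) + 4 * (1 - w) ^ 2) - 27 - 4 * H * 0)) := by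
    have h1 : Tendsto (fun n : ℕ => 1 - (B n : ℝ) / n) atTop (nhds (1 - w)) :=
      tendsto_const_nhds.sub hB
    exact ((((((hB.pow 2).const_mul 2).add ((hB.mul h1).const_mul _)).add
      ((h1.pow 2).const_mul 4)).const_mul H).sub_const 27).sub (hinv.const_mul _)
  have hu : Tendsto (fun n : ℕ => 2 * r * (H + (K : ℝ) ^ 2 * ((n : ℝ))⁻¹)) atTop
      (nhds (2 * r * (H + (K : ℝ) ^ 2 * 0))) :=
    ((hinv.const_mul _).const_add H).const_mul _
  have := le_of_tendsto_of_tendsto hl hu <| by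
    filter_upwards [eventually_ge_atTop 2] with n hn
    have hn0 : (0 : ℝ) < n := by exact_mod_cast (by omega : 0 < n)
    have := (A n (B n)).le_of_ratio_le (hBn n hn) hr (h n hn) hK
    refine le_of_mul_le_mul_right (le_trans (le_of_eq ?_) (this.trans (le_of_eq ?_)))
      (show 0 < (n : ℝ) ^ 2 by positivity)
    · change _ = H * _ - _ - 4 * n * H
      field_simp
    · change 2 * r * (H * _ + _) = _
      field_simp
  linarith

end Scheduling

theorem corollary2 (w : ℝ) (hw : w ∈ Set.Icc (0 : ℝ) 1)
    (B : ℕ → ℕ) (hBn : ∀ n, 2 ≤ n → B n ≤ n)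
    (hB : (fun n : ℕ => (B n : ℝ) - w * n) =o[atTop] (fun n : ℕ => (n : ℝ)))
    (A : (n b : ℕ) → Scheduling.RandomizedAlgorithm n b) :
    ENNReal.ofReal ((2 - w) - (3 - 2 * Real.sqrt 2) * w * (1 - w)) ≤
      Scheduling.competitiveRatio B A := by
  by_cases htop : Scheduling.competitiveRatio B A = ⊤
  · rw [htop]
    exact le_top
  set r := (Scheduling.competitiveRatio B A).toReal with hr
  have hR : ENNReal.ofReal r = Scheduling.competitiveRatio B A := ENNReal.ofReal_toReal htop
  have hr0 : 0 ≤ r := ENNReal.toReal_nonneg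
  have hlim : Tendsto (fun n : ℕ => (B n : ℝ) / n) atTop (nhds w) := by
    have h1 := hB.tendsto_div_nhds_zero.add_const w
    rw [zero_add] at h1
    refine h1.congr' ?_
    filter_upwards [eventually_gt_atTop 0] with n hn
    have hn0 : (n : ℝ) ≠ 0 := by exact_mod_cast hn.ne'
    field_simp
    ring
  have hratio : ∀ n, 2 ≤ n → (A n (B n)).ratio ≤ ENNReal.ofReal r := fun n hn => by
    rw [hR]
    exact le_iSup₂ (f := fun n (_ : 2 ≤ n) => (A n (B n)).ratio) n hn
  rw [← hR]
  refine ENNReal.ofReal_le_ofReal ?_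
  by_contra! hlt
  -- Twice the supposed gap. The bound for fixed `K` gives Hδ ≤ 27, which fails once H exceeds 27/δ.
  set δ := 2 * ((2 - w) - (3 - 2 * √2) * w * (1 - w) - r) with hδ
  have hδ0 : 0 < δ := by linarith
  obtain ⟨K, hK, hHK⟩ := ((eventually_gt_atTop 0).and
    (Scheduling.tendsto_harmonicSum.eventually_gt_atTop (27 / δ))).exists
  have h1 := Scheduling.harmonicSum_mul_le_of_ratio_le hBn hlim A hr0 hratio hK
  rw [div_lt_iff₀ hδ0] at hHK
  have h2 : Scheduling.harmonicSum K * δ = Scheduling.harmonicSum K *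
      (2 * w ^ 2 + 4 * √2 * (w * (1 - w)) + 4 * (1 - w) ^ 2) -
        2 * r * Scheduling.harmonicSum K := by
    rw [hδ]
    ring
  linarith
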